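/- Let $D\subset\mathbb R^n$ be a bounded convex polyhedron (the convex hull of a finite set of points), let $D_0$ be its set of vertices, and let $\widetilde D_1$ be the graph of its $1$-skeleton: its vertices are the vertices of $D$ and its edges are the (closed, one-dimensional) edges of $D$. Let $U\subseteq\mathbb R^n$ be an arbitrary convex set, not necessarily open or closed. Let $\widetilde D_1\setminus U$ be the graph obtained from $\widetilde D_1$ by deleting all vertices that belong to $U$ and all edges that have non-empty intersection with $U$. The path-connected components of $D\setminus U$ are in one-to-one correspondence with the connected components of the graph $\widetilde D_1\setminus U$: for each path-connected component $W$ of $D\setminus U$ the set $W\cap D_0$ is the vertex set of exactly one connected component of $\widetilde D_1\setminus U$, and for each connected component of $\widetilde D_1\setminus U$, with vertex set $V_0$, there is exactly one path-connected component $W$ of $D\setminus U$ with $W\cap D_0=V_0$. Moreover, let $V_0$ be the vertex set of a connected component of $\widetilde D_1\setminus U$, and let $W$ be the corresponding path-connected component of $D\setminus U$, that is, $W\cap D_0=V_0$. Let $E_{\rm out}(V_0)$ be the set of edges of $D$ that connect a vertex from $V_0$ with a vertex from $D_0\setminus V_0$. For each $e\in E_{\rm out}(V_0)$ select an arbitrary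 point $x_e\in U\cap e$, and let $Q_0=\{x_e \mid e\in E_{\rm out}(V_0)\}$. Then $$W=\operatorname{conv}(Q_0\cup V_0)\setminus U .$$ -/

import Mathlib

/-- A bounded convex polyhedron (a polytope): the convex hull of a finite set of points. -/
def IsBoundedPolyhedron {n : ℕ} (D : Set (EuclideanSpace ℝ (Fin n))) : Prop :=
  ∃ S : Set (EuclideanSpace ℝ (Fin n)), S.Finite ∧ D = convexHull ℝ S

/-- The set `D₀` of vertices of `D`. -/
abbrev polyVertices {n : ℕ} (D : Set (EuclideanSpace ℝ (Fin n))) :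
    Set (EuclideanSpace ℝ (Fin n)) :=
  D.extremePoints ℝ

/-- `e` is the (closed) edge of `D` with the ends `v ≠ w`: the segment `[v, w]` and a face of `D`.
Every one-dimensional face of a bounded polyhedron is of this form. -/
def IsEdgeBetween {n : ℕ} (D : Set (EuclideanSpace ℝ (Fin n))) (v w : EuclideanSpace ℝ (Fin n))
    (e : Set (EuclideanSpace ℝ (Fin n))) : Prop :=
  v ≠ w ∧ e = segment ℝ v w ∧ IsExtreme ℝ D e

/-- The graph of the 1-skeleton of `D` cut by `U`: all vertices of `D` that belong to `U` and all
edges of `D` that meet `U` are deleted. For `U = ∅` this is the graph of the 1-skeleton itself. -/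
def cutGraph {n : ℕ} (D U : Set (EuclideanSpace ℝ (Fin n))) :
    SimpleGraph ↥(polyVertices D \ U) where
  Adj v w := ∃ e, IsEdgeBetween D v w e ∧ e ∩ U = ∅
  symm := ⟨by
    rintro v w ⟨e, ⟨hne, he, hf⟩, hU⟩
    exact ⟨e, ⟨hne.symm, by rw [he, segment_symm], hf⟩, hU⟩⟩
  loopless := ⟨by
    rintro v ⟨e, ⟨hne, -, -⟩, -⟩
    exact hne rfl⟩

/-- The set of vertices of `D` that belong to a connected component of the cut graph. -/
def componentVertices {n : ℕ} {D U : Set (EuclideanSpace ℝ (Fin n))}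
    (C : (cutGraph D U).ConnectedComponent) : Set (EuclideanSpace ℝ (Fin n)) :=
  Subtype.val '' C.supp

/-- The outer edges of a set `V` of vertices of `D`: the edges of `D` that connect a vertex from
`V` with a vertex of `D` outside `V`. -/
def outerEdges {n : ℕ} (D V : Set (EuclideanSpace ℝ (Fin n))) :
    Set (Set (EuclideanSpace ℝ (Fin n))) :=
  {e | ∃ v ∈ V, ∃ w ∈ polyVertices D \ V, IsEdgeBetween D v w e}

/-- `W` is a path-connected component of the set `P`. -/
def IsPathComponentOf {n : ℕ} (W P : Set (EuclideanSpace ℝ (Fin n))) : Prop :=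
  ∃ x ∈ P, W = pathComponentIn P x

/-! Since `U` need be neither open nor closed, half-spaces are replaced by hemispaces: convex sets
`A` with convex complement. Every point outside `U` lies in a hemispace `A` disjoint from `U`. Then
`D ∩ A` is convex and avoids `U`, and if it is nonempty, it contains a vertex. A simplex-method
argument (`exists_edge_of_convex_compl`) shows that the vertices in `A` are linked by edges inside
`A`, so they all lie in one component of the cut graph. Thus every point of `D \ U` is joined to a
vertex.

For the formula, `conv (Q₀ ∪ V₀)` and `conv (Q₀ ∪ (D₀ \ V₀))` are closed and cover `D`. A point
outside `U` common to both would have a hemispace containing vertices of both classes, which is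
impossible. Connectedness then confines the path component of `V₀` to the first hull. -/

section ExtremePoints

/-! ### Edges from a vertex and the simplex method. -/

variable {E : Type*} [NormedAddCommGroup E] [NormedSpace ℝ E] {D : Set E}

theorem convexHull_extremePoints_eq_of_finite (hfin : (D.extremePoints ℝ).Finite)
    (hc : IsCompact D) (hD : Convex ℝ D) : convexHull ℝ (D.extremePoints ℝ) = D := by
  rw [← (hfin.isClosed_convexHull ℝ).closure_eq]
  exact closure_convexHull_extremePoints hc hD

theorem exists_dual_lt_of_mem_extremePoints (hfin : (D.extremePoints ℝ).Finite)
    (hD : Convex ℝ D) {v : E} (hv : v ∈ D.extremePoints ℝ) :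
    ∃ g : StrongDual ℝ E, ∀ u ∈ D.extremePoints ℝ, u ≠ v → g u < g v := by
  have hnot : v ∉ convexHull ℝ (D.extremePoints ℝ \ {v}) := fun h =>
    (hD.mem_extremePoints_iff_mem_sdiff_convexHull_sdiff.1 hv).2
      (convexHull_mono (Set.sdiff_subset_sdiff_left extremePoints_subset) h)
  obtain ⟨g, c, hg, hc⟩ := geometric_hahn_banach_closed_point (convex_convexHull ℝ _)
    ((hfin.subset Set.sdiff_subset).isClosed_convexHull ℝ) hnot
  exact ⟨g, fun u hu huv => (hg u (subset_convexHull ℝ _ ⟨hu, huv⟩)).trans hc⟩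

/-- Used with `g = 1` on `P`: the set is then the cone with apex `v` over `v + P`. -/
theorem convex_setOf_eq_add_smul {P : Set E} (hP : Convex ℝ P) (g : StrongDual ℝ E) (v : E) :
    Convex ℝ {x : E | 0 ≤ g (x - v) ∧ ∃ q ∈ P, x - v = g (x - v) • q} := by
  rintro x ⟨hx, q, hq, hxq⟩ y ⟨hy, r, hr, hyr⟩ a b ha hb hab
  have hsub : a • x + b • y - v = a • (x - v) + b • (y - v) := by
    have : v = (a + b) • v := by rw [hab, one_smul]
    conv_lhs => rw [this]
    module
  have hg : g (a • x + b • y - v) = a * g (x - v) + b * g (y - v) := by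
    rw [hsub]; simp only [map_add, map_smul, smul_eq_mul]
  set s := g (x - v)
  set t := g (y - v)
  have has : 0 ≤ a * s := mul_nonneg ha hx
  have hbt : 0 ≤ b * t := mul_nonneg hb hy
  refine ⟨hg ▸ add_nonneg has hbt, ?_⟩
  rw [hg, hsub, hxq, hyr]
  rcases (add_nonneg has hbt).eq_or_lt with h | h
  · refine ⟨q, hq, ?_⟩
    have h1 : a * s = 0 := by linarith
    have h2 : b * t = 0 := by linarith
    rw [smul_smul, smul_smul, h1, h2]
    simp
  · refine ⟨(a * s / (a * s + b * t)) • q + (b * t / (a * s + b * t)) • r,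
      hP hq hr (by positivity) (by positivity) (by field_simp), ?_⟩
    rw [smul_add, smul_smul, smul_smul, smul_smul, smul_smul, mul_div_cancel₀ _ h.ne',
      mul_div_cancel₀ _ h.ne']

/-- Take the vertex figure `P`: directions from `v` to the other vertices, scaled to `g = 1`. As `f`
is positive somewhere on `P`, it is positive at an extreme point of `P`, and extreme directions span
edges. -/
theorem exists_increasing_edge (hfin : (D.extremePoints ℝ).Finite)
    (hD : convexHull ℝ (D.extremePoints ℝ) = D) {v u : E} (hv : v ∈ D.extremePoints ℝ)
    (hu : u ∈ D.extremePoints ℝ) (f : StrongDual ℝ E) (hf : f v < f u) :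
    ∃ w ∈ D.extremePoints ℝ, f v < f w ∧ IsExtreme ℝ D (segment ℝ v w) := by
  have hconv : Convex ℝ D := hD ▸ convex_convexHull ℝ _
  obtain ⟨g', hg'⟩ := exists_dual_lt_of_mem_extremePoints hfin hconv hv
  obtain ⟨g, hg⟩ : ∃ g : StrongDual ℝ E, ∀ u ∈ D.extremePoints ℝ, u ≠ v → 0 < g (u - v) :=
    ⟨-g', fun u hu huv => by simpa using hg' u hu huv⟩
  set S : Set E := (fun w => (g (w - v))⁻¹ • (w - v)) '' (D.extremePoints ℝ \ {v})
  set P := convexHull ℝ S with hP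
  have hSfin : S.Finite := (hfin.subset Set.sdiff_subset).image _
  have huv : u ≠ v := by rintro rfl; exact lt_irrefl _ hf
  have huS : (g (u - v))⁻¹ • (u - v) ∈ P := subset_convexHull ℝ _ ⟨u, ⟨hu, huv⟩, rfl⟩
  obtain ⟨p, hp, hfp⟩ : ∃ p ∈ P.extremePoints ℝ, 0 < f p := by
    by_contra! h
    have h1 : P ⊆ {y | f y ≤ 0} := by
      rw [hP, ← closure_convexHull_extremePoints (hSfin.isCompact_convexHull ℝ) (convex_convexHull ℝ S)]
      refine closure_minimal (convexHull_min (fun y hy => h y hy) ?_) (isClosed_le f.continuous continuous_const)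
      exact convex_halfSpace_le f.isBoundedLinearMap.toIsLinearMap 0
    have h2 : f ((g (u - v))⁻¹ • (u - v)) ≤ 0 := h1 huS
    rw [map_smul, smul_eq_mul, map_sub f] at h2
    have := mul_pos (inv_pos.2 (hg u hu huv)) (sub_pos.2 hf)
    linarith
  have hcone : D ⊆ {x : E | 0 ≤ g (x - v) ∧ ∃ q ∈ P, x - v = g (x - v) • q} := by
    conv_lhs => rw [← hD]
    refine convexHull_min (fun w hw => ?_) (convex_setOf_eq_add_smul (convex_convexHull ℝ S) g v)
    by_cases hwv : w = v
    · subst hwv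
      exact ⟨by simp, _, huS, by simp⟩
    · exact ⟨(hg w hw hwv).le, _, subset_convexHull ℝ _ ⟨w, ⟨hw, hwv⟩, rfl⟩,
        (smul_inv_smul₀ (hg w hw hwv).ne' _).symm⟩
  obtain ⟨w, ⟨hw, hwv⟩, hwp⟩ := extremePoints_convexHull_subset hp
  have hgw := hg w hw hwv
  have hwp' : w - v = g (w - v) • p := by
    rw [← hwp]; exact (smul_inv_smul₀ hgw.ne' _).symm
  refine ⟨w, hw, ?_, hconv.segment_subset hv.1 hw.1, ?_⟩
  · have : f (w - v) = g (w - v) * f p := by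
      conv_lhs => rw [hwp', map_smul, smul_eq_mul]
    rw [map_sub] at this
    have := mul_pos hgw hfp
    linarith
  · intro x hx y hy z hz hzxy
    obtain ⟨hgx, q, hq, hxq⟩ := hcone hx
    obtain ⟨hgy, r, hr, hyr⟩ := hcone hy
    -- points of `D` on the ray from `v` through `w` lie on the segment
    have hray : x - v = g (x - v) • p → x ∈ segment ℝ v w := by
      intro hxp
      rw [segment_eq_image']
      by_cases hle : g (x - v) ≤ g (w - v)
      · refine ⟨g (x - v) / g (w - v), ⟨by positivity, (div_le_one hgw).2 hle⟩, ?_⟩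
        have : (g (x - v) / g (w - v)) • (w - v) = x - v :=
          calc _ = g (x - v) • ((g (w - v))⁻¹ • (w - v)) := by rw [smul_smul, div_eq_mul_inv]
            _ = g (x - v) • p := by rw [← hwp]
            _ = x - v := hxp.symm
        simp only [this]
        abel
      -- A point of `D` beyond `w` on the ray would put the vertex `w` strictly between it and `v`.
      · exfalso
        push Not at hle
        have hgx' : 0 < g (x - v) := hgw.trans hle
        have hmem : w ∈ openSegment ℝ v x := by
          rw [openSegment_eq_image']
          refine ⟨g (w - v) / g (x - v), ⟨by positivity, (div_lt_one hgx').2 hle⟩, ?_⟩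
          have : (g (w - v) / g (x - v)) • (x - v) = w - v :=
            calc _ = (g (w - v) / g (x - v)) • (g (x - v) • p) := congrArg _ hxp
              _ = g (w - v) • p := by rw [smul_smul, div_mul_cancel₀ _ hgx'.ne']
              _ = w - v := hwp'.symm
          simp only [this]
          abel
        exact hwv (hw.2 hv.1 hx hmem).symm
    rcases hgx.eq_or_lt with h0 | hgx'
    · exact hray (by rw [hxq, ← h0]; simp)
    obtain ⟨a, b, ha, hb, hab, rfl⟩ := hzxy
    rw [segment_eq_image'] at hz
    obtain ⟨t, -, ht⟩ := hz
    have hsub : a • (x - v) + b • (y - v) = t • (w - v) := by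
      have h1 : v = (a + b) • v := by rw [hab, one_smul]
      have h2 : t • (w - v) = a • x + b • y - v := by rw [← ht]; simp
      rw [h2]
      conv_rhs => rw [h1]
      module
    have hsum : a * g (x - v) + b * g (y - v) = t * g (w - v) := by
      have := congrArg g hsub
      simpa only [map_add, map_smul, smul_eq_mul] using this
    have hcomb : (a * g (x - v)) • q + (b * g (y - v)) • r = (t * g (w - v)) • p := by
      rw [mul_smul, mul_smul, mul_smul, ← hxq, ← hyr, ← hwp', hsub]
    have hax : 0 < a * g (x - v) := mul_pos ha hgx'
    rcases hgy.eq_or_lt with h0 | hgy'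
    · rw [← h0, mul_zero, add_zero] at hsum
      rw [← h0, mul_zero, zero_smul, add_zero, ← hsum] at hcomb
      exact hray (by rw [← smul_right_injective E hax.ne' hcomb]; exact hxq)
    · have hby : 0 < b * g (y - v) := mul_pos hb hgy'
      have hpos : 0 < t * g (w - v) := hsum ▸ add_pos hax hby
      -- Rescaling to height `g = 1` makes `p` a proper convex combination of `q` and `r`.
      have hmem : p ∈ openSegment ℝ q r := by
        refine ⟨a * g (x - v) / (t * g (w - v)), b * g (y - v) / (t * g (w - v)),
          by positivity, by positivity, by rw [← add_div, hsum, div_self hpos.ne'], ?_⟩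
        rw [div_eq_inv_mul, div_eq_inv_mul, mul_smul _ (a * _), mul_smul _ (b * _), ← smul_add, hcomb,
          inv_smul_smul₀ hpos.ne']
      have hqp : q = p := hp.2 hq hr hmem
      exact hray (hqp ▸ hxq)

/-- The vertices of a polytope in a convex set with convex complement cannot be divided into two
nonempty classes without an edge between them. -/
theorem exists_edge_of_convex_compl (hfin : (D.extremePoints ℝ).Finite)
    (hD : convexHull ℝ (D.extremePoints ℝ) = D) {A : Set E} (hA : Convex ℝ A)
    (hA' : Convex ℝ Aᶜ) (T : Set E) {v w : E} (hv : v ∈ D.extremePoints ℝ) (hvA : v ∈ A)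
    (hvT : v ∈ T) (hw : w ∈ D.extremePoints ℝ) (hwA : w ∈ A) (hwT : w ∉ T) :
    ∃ p ∈ D.extremePoints ℝ, ∃ q ∈ D.extremePoints ℝ, p ∈ A ∧ q ∈ A ∧ p ∈ T ∧ q ∉ T ∧
      IsExtreme ℝ D (segment ℝ p q) := by
  have hconv : Convex ℝ D := hD ▸ convex_convexHull ℝ _
  have hVA : (D.extremePoints ℝ ∩ A).Finite := hfin.subset Set.inter_subset_left
  have hVA' : (D.extremePoints ℝ ∩ Aᶜ).Finite := hfin.subset Set.inter_subset_left
  have hdisj : Disjoint (convexHull ℝ (D.extremePoints ℝ ∩ Aᶜ))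
      (convexHull ℝ (D.extremePoints ℝ ∩ A)) :=
    (disjoint_compl_left (a := A)).mono (convexHull_min Set.inter_subset_right hA')
      (convexHull_min Set.inter_subset_right hA)
  obtain ⟨f, c, d, hfc, hcd, hfd⟩ := geometric_hahn_banach_closed_compact (convex_convexHull ℝ _)
    (hVA'.isClosed_convexHull ℝ) (convex_convexHull ℝ _) (hVA.isCompact_convexHull ℝ) hdisj
  obtain ⟨m, ⟨hm, hmA⟩, hmax⟩ := hVA.exists_maximalFor f _ ⟨v, hv, hvA⟩
  obtain ⟨g, hg⟩ := exists_dual_lt_of_mem_extremePoints hfin hconv hm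
  -- a perturbation of `f` with its only maximum at `m`
  obtain ⟨h, hlt, hhm⟩ : ∃ h : StrongDual ℝ E,
      (∀ p ∈ D.extremePoints ℝ ∩ A, ∀ q ∈ D.extremePoints ℝ ∩ Aᶜ, h q < h p) ∧
      ∀ q ∈ D.extremePoints ℝ, q ≠ m → h q < h m := by
    have hev : ∀ᶠ ε : ℝ in nhdsWithin 0 (Set.Ioi 0), ∀ p ∈ D.extremePoints ℝ ∩ A,
        ∀ q ∈ D.extremePoints ℝ ∩ Aᶜ, (f + ε • g) q < (f + ε • g) p := by
      rw [Filter.eventually_all_finite hVA]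
      intro p hp
      rw [Filter.eventually_all_finite hVA']
      intro q hq
      refine Filter.Eventually.filter_mono nhdsWithin_le_nhds ?_
      have h1 : f q < f p := ((hfc q (subset_convexHull ℝ _ hq)).trans hcd).trans
        (hfd p (subset_convexHull ℝ _ hp))
      refine ContinuousAt.eventually_lt (f := fun ε : ℝ => (f + ε • g) q)
        (g := fun ε : ℝ => (f + ε • g) p) ?_ ?_ (by simpa using h1)
      · simp only [add_apply, smul_apply]; fun_prop
      · simp only [add_apply, smul_apply]; fun_prop
    obtain ⟨ε, hε, hpos⟩ := (hev.and self_mem_nhdsWithin).exists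
    refine ⟨f + ε • g, hε, fun q hq hqm => ?_⟩
    by_cases hqA : q ∈ A
    · have h1 : f q ≤ f m := by
        by_contra! hlt
        exact absurd (hmax ⟨hq, hqA⟩ hlt.le) (not_le.2 hlt)
      have h2 : ε * g q < ε * g m := mul_lt_mul_of_pos_left (hg q hq hqm) hpos
      simpa using add_lt_add_of_le_of_lt h1 h2
    · exact hε m ⟨hm, hmA⟩ q ⟨hq, hqA⟩
  -- The `h`-highest vertex of `A ∩ R` is not `m`, so an edge increases `h` from it. Its upper end
  -- stays in `A`, where `h` is larger than at the vertices outside, and leaves `R` by maximality.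
  have key : ∀ R : Set E, (D.extremePoints ℝ ∩ A ∩ R).Nonempty → m ∉ R →
      ∃ p ∈ D.extremePoints ℝ, ∃ q ∈ D.extremePoints ℝ, p ∈ A ∧ q ∈ A ∧ p ∈ R ∧ q ∉ R ∧
        IsExtreme ℝ D (segment ℝ p q) := by
    intro R hR hmR
    obtain ⟨p, ⟨⟨hp, hpA⟩, hpR⟩, hpmax⟩ :=
      (hVA.subset Set.inter_subset_left).exists_maximalFor h _ hR
    obtain ⟨q, hq, hpq, he⟩ := exists_increasing_edge hfin hD hp hm h
      (hhm p hp (by rintro rfl; exact hmR hpR))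
    have hqA : q ∈ A := by
      by_contra hqA
      exact lt_asymm hpq (hlt p ⟨hp, hpA⟩ q ⟨hq, hqA⟩)
    refine ⟨p, hp, q, hq, hpA, hqA, hpR, fun hqR => ?_, he⟩
    exact absurd (hpmax ⟨⟨hq, hqA⟩, hqR⟩ hpq.le) (not_le.2 hpq)
  by_cases hmT : m ∈ T
  · obtain ⟨p, hp, q, hq, hpA, hqA, hpT, hqT, he⟩ :=
      key Tᶜ ⟨w, ⟨hw, hwA⟩, hwT⟩ (by simpa using hmT)
    exact ⟨q, hq, p, hp, hqA, hpA, by simpa using hqT, hpT, segment_symm ℝ p q ▸ he⟩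
  · exact key T ⟨v, ⟨hv, hvA⟩, hvT⟩ hmT

end ExtremePoints

section Segments

/-! ### Segments and hemispaces. -/

variable {E : Type*} [AddCommGroup E] [Module ℝ E]

theorem mem_segment_or_mem_segment {a b x y : E} (hx : x ∈ segment ℝ a b)
    (hy : y ∈ segment ℝ a b) : y ∈ segment ℝ a x ∨ y ∈ segment ℝ x b := by
  rw [segment_eq_image_lineMap] at hx hy
  obtain ⟨s, ⟨hs0, hs1⟩, rfl⟩ := hx
  obtain ⟨t, ⟨ht0, ht1⟩, rfl⟩ := hy
  rcases le_total t s with h | h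
  · left
    have := (image_segment ℝ (AffineMap.lineMap a b : ℝ →ᵃ[ℝ] E) 0 s).subset
      ⟨t, by rw [segment_eq_Icc hs0]; exact ⟨ht0, h⟩, rfl⟩
    simpa using this
  · right
    have := (image_segment ℝ (AffineMap.lineMap a b : ℝ →ᵃ[ℝ] E) s 1).subset
      ⟨t, by rw [segment_eq_Icc hs1]; exact ⟨h, ht1⟩, rfl⟩
    simpa using this

theorem exists_mem_of_mem_convexHull_union {A Q V : Set E} (hA' : Convex ℝ Aᶜ) (hQ : Q ⊆ Aᶜ)
    {x : E} (hx : x ∈ convexHull ℝ (Q ∪ V)) (hxA : x ∈ A) : ∃ v ∈ V, v ∈ A := by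
  by_contra! h
  exact convexHull_min (Set.union_subset hQ h) hA' hx hxA

theorem exists_mem_of_mem_convexHull {A V : Set E} (hA' : Convex ℝ Aᶜ)
    {x : E} (hx : x ∈ convexHull ℝ V) (hxA : x ∈ A) : ∃ v ∈ V, v ∈ A :=
  exists_mem_of_mem_convexHull_union hA' (Set.empty_subset _) (by rwa [Set.empty_union]) hxA

theorem Convex.exists_convex_compl_of_notMem {U : Set E} (hU : Convex ℝ U) {x : E} (hx : x ∉ U) :
    ∃ A : Set E, Convex ℝ A ∧ Convex ℝ Aᶜ ∧ x ∈ A ∧ U ⊆ Aᶜ := by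
  obtain ⟨A, hA, hA', hxA, hUA⟩ := exists_convex_convex_compl_subset (convex_singleton x) hU
    (Set.disjoint_singleton_left.2 hx)
  exact ⟨A, hA, hA', hxA rfl, hUA⟩

end Segments

section CutGraph

/-! ### Components of the cut graph and of `D \ U`. -/

variable {n : ℕ} {D U : Set (EuclideanSpace ℝ (Fin n))}

theorem IsBoundedPolyhedron.convex (hD : IsBoundedPolyhedron D) : Convex ℝ D := by
  obtain ⟨S, -, rfl⟩ := hD
  exact convex_convexHull ℝ S

theorem IsBoundedPolyhedron.finite_polyVertices (hD : IsBoundedPolyhedron D) :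
    (polyVertices D).Finite := by
  obtain ⟨S, hS, rfl⟩ := hD
  exact hS.subset extremePoints_convexHull_subset

theorem IsBoundedPolyhedron.convexHull_polyVertices (hD : IsBoundedPolyhedron D) :
    convexHull ℝ (polyVertices D) = D := by
  refine convexHull_extremePoints_eq_of_finite hD.finite_polyVertices ?_ hD.convex
  obtain ⟨S, hS, rfl⟩ := hD
  exact hS.isCompact_convexHull ℝ

theorem finite_outerEdges (hD : IsBoundedPolyhedron D) {V : Set (EuclideanSpace ℝ (Fin n))}
    (hV : V ⊆ polyVertices D) : (outerEdges D V).Finite := by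
  refine ((hD.finite_polyVertices.prod hD.finite_polyVertices).image
    fun p => segment ℝ p.1 p.2).subset ?_
  rintro e ⟨v, hv, w, hw, -, rfl, -⟩
  exact ⟨(v, w), ⟨hV hv, hw.1⟩, rfl⟩

theorem componentVertices_subset (C : (cutGraph D U).ConnectedComponent) :
    componentVertices C ⊆ polyVertices D \ U := by
  rintro _ ⟨v, -, rfl⟩
  exact v.2

theorem componentVertices_injective :
    Function.Injective (componentVertices (D := D) (U := U)) := fun _ _ h =>
  SimpleGraph.ConnectedComponent.supp_injective (Subtype.val_injective.image_injective h)

theorem componentVertices_nonempty (C : (cutGraph D U).ConnectedComponent) :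
    (componentVertices C).Nonempty := C.nonempty_supp.image _

theorem mem_componentVertices_mk {v : EuclideanSpace ℝ (Fin n)} (hv : v ∈ polyVertices D \ U) :
    v ∈ componentVertices ((cutGraph D U).connectedComponentMk ⟨v, hv⟩) :=
  ⟨⟨v, hv⟩, rfl, rfl⟩

theorem mem_componentVertices_of_isEdgeBetween {C : (cutGraph D U).ConnectedComponent}
    {v w : EuclideanSpace ℝ (Fin n)} (hv : v ∈ componentVertices C) (hw : w ∈ polyVertices D)
    {e : Set (EuclideanSpace ℝ (Fin n))} (he : IsEdgeBetween D v w e) (heU : e ∩ U = ∅) :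
    w ∈ componentVertices C := by
  obtain ⟨v, hvC, rfl⟩ := hv
  have hwU : w ∉ U := fun h =>
    heU.subset ⟨he.2.1 ▸ right_mem_segment ℝ _ _, h⟩
  exact ⟨⟨w, hw, hwU⟩, C.mem_supp_of_adj_mem_supp hvC ⟨e, he, heU⟩, rfl⟩

theorem inter_nonempty_of_mem_outerEdges {C : (cutGraph D U).ConnectedComponent}
    {e : Set (EuclideanSpace ℝ (Fin n))} (he : e ∈ outerEdges D (componentVertices C)) :
    (U ∩ e).Nonempty := by
  obtain ⟨v, hv, w, hw, he⟩ := he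
  rw [Set.inter_comm]
  by_contra h
  exact hw.2 (mem_componentVertices_of_isEdgeBetween hv hw.1 he (Set.not_nonempty_iff_eq_empty.1 h))

/-- Otherwise some edge inside `A` would leave the component, yet an edge inside `A` avoids `U` and
so survives in the cut graph. -/
theorem mem_componentVertices_of_convex_compl (hD : IsBoundedPolyhedron D)
    {A : Set (EuclideanSpace ℝ (Fin n))} (hA : Convex ℝ A) (hA' : Convex ℝ Aᶜ) (hUA : U ⊆ Aᶜ)
    {C : (cutGraph D U).ConnectedComponent} {v w : EuclideanSpace ℝ (Fin n)}
    (hv : v ∈ componentVertices C) (hvA : v ∈ A) (hw : w ∈ polyVertices D) (hwA : w ∈ A) :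
    w ∈ componentVertices C := by
  by_contra hwC
  obtain ⟨p, -, q, hq, hpA, hqA, hpC, hqC, he⟩ :=
    exists_edge_of_convex_compl hD.finite_polyVertices hD.convexHull_polyVertices hA hA'
      (componentVertices C) (componentVertices_subset C hv).1 hvA hv hw hwA hwC
  refine hqC (mem_componentVertices_of_isEdgeBetween hpC hq
    ⟨by rintro rfl; exact hqC hpC, rfl, he⟩ ?_)
  exact Set.disjoint_iff_inter_eq_empty.1 (Set.disjoint_left.2 fun y hy hyU =>
    hUA hyU (hA.segment_subset hpA hqA hy))

/-- A point of `D` lies on a segment from `conv V` to the hull of the other vertices. This segment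
meets the hull of the chosen points, which splits it into one piece for each hull. -/
theorem subset_union_convexHull_outerEdges (hD : IsBoundedPolyhedron D)
    {V : Set (EuclideanSpace ℝ (Fin n))} (hV : V ⊆ polyVertices D) (hne : V.Nonempty)
    {x : Set (EuclideanSpace ℝ (Fin n)) → EuclideanSpace ℝ (Fin n)}
    (hx : ∀ e ∈ outerEdges D V, x e ∈ e) :
    D ⊆ convexHull ℝ (x '' outerEdges D V ∪ V) ∪
      convexHull ℝ (x '' outerEdges D V ∪ polyVertices D \ V) := by
  intro y hy
  rw [← hD.convexHull_polyVertices, ← Set.union_sdiff_cancel hV] at hy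
  rcases (polyVertices D \ V).eq_empty_or_nonempty with h | hne'
  · rw [h, Set.union_empty] at hy
    exact Or.inl (convexHull_mono Set.subset_union_right hy)
  rw [convexHull_union hne hne', mem_convexJoin] at hy
  obtain ⟨p, hp, q, hq, hy⟩ := hy
  obtain ⟨z, hz, hzQ⟩ : ∃ z ∈ segment ℝ p q, z ∈ convexHull ℝ (x '' outerEdges D V) := by
    -- A hemispace containing the segment and missing the hull would contain an outer edge, and with
    -- it the point chosen there.
    by_contra! h
    obtain ⟨A, hA, hA', hpq, hQ⟩ := exists_convex_convex_compl_subset (convex_segment p q)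
      (convex_convexHull ℝ (x '' outerEdges D V)) (Set.disjoint_left.2 h)
    obtain ⟨v, hv, hvA⟩ := exists_mem_of_mem_convexHull hA' hp (hpq (left_mem_segment ℝ p q))
    obtain ⟨w, hw, hwA⟩ := exists_mem_of_mem_convexHull hA' hq (hpq (right_mem_segment ℝ p q))
    obtain ⟨p', -, q', hq', hpA, hqA, hpV, hqV, he⟩ :=
      exists_edge_of_convex_compl hD.finite_polyVertices hD.convexHull_polyVertices hA hA'
        V (hV hv) hvA hv hw.1 hwA hw.2
    have hmem : segment ℝ p' q' ∈ outerEdges D V :=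
      ⟨p', hpV, q', ⟨hq', hqV⟩, by rintro rfl; exact hqV hpV, rfl, he⟩
    exact hQ (subset_convexHull ℝ _ ⟨_, hmem, rfl⟩) (hA.segment_subset hpA hqA (hx _ hmem))
  refine (mem_segment_or_mem_segment hz hy).imp (fun h => ?_) (fun h => ?_)
  · exact (convex_convexHull ℝ _).segment_subset (convexHull_mono Set.subset_union_right hp)
      (convexHull_mono Set.subset_union_left hzQ) h
  · exact (convex_convexHull ℝ _).segment_subset (convexHull_mono Set.subset_union_left hzQ)
      (convexHull_mono Set.subset_union_right hq) h

theorem joinedIn_of_convex_compl (hD : Convex ℝ D) {A : Set (EuclideanSpace ℝ (Fin n))}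
    (hA : Convex ℝ A) (hUA : U ⊆ Aᶜ) {x y : EuclideanSpace ℝ (Fin n)} (hx : x ∈ D) (hxA : x ∈ A)
    (hy : y ∈ D) (hyA : y ∈ A) : JoinedIn (D \ U) x y := by
  refine (JoinedIn.of_segment_subset (s := D ∩ A) ((hD.inter hA).segment_subset ⟨hx, hxA⟩
    ⟨hy, hyA⟩)).mono fun z hz => ⟨hz.1, fun hzU => hUA hzU hz.2⟩

theorem joinedIn_of_mem_componentVertices
    {C : (cutGraph D U).ConnectedComponent} {v w : EuclideanSpace ℝ (Fin n)}
    (hv : v ∈ componentVertices C) (hw : w ∈ componentVertices C) : JoinedIn (D \ U) v w := by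
  obtain ⟨v, hv, rfl⟩ := hv
  obtain ⟨w, hw, rfl⟩ := hw
  obtain ⟨p⟩ := C.reachable_of_mem_supp hv hw
  clear hv hw
  induction p with
  | @nil a => exact JoinedIn.refl ⟨a.2.1.1, a.2.2⟩
  | @cons a b c hadj _ ih =>
    refine JoinedIn.trans ?_ ih
    obtain ⟨e, ⟨-, rfl, he⟩, heU⟩ := hadj
    exact JoinedIn.of_segment_subset fun z hz => ⟨he.subset hz, fun hzU => heU.subset ⟨hz, hzU⟩⟩

theorem pathComponentIn_eq_convexHull_sdiff (hD : IsBoundedPolyhedron D) (hU : Convex ℝ U)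
    {C : (cutGraph D U).ConnectedComponent} {v : EuclideanSpace ℝ (Fin n)}
    (hv : v ∈ componentVertices C)
    {x : Set (EuclideanSpace ℝ (Fin n)) → EuclideanSpace ℝ (Fin n)}
    (hx : ∀ e ∈ outerEdges D (componentVertices C), x e ∈ U ∩ e) :
    pathComponentIn (D \ U) v = convexHull ℝ
      (x '' outerEdges D (componentVertices C) ∪ componentVertices C) \ U := by
  have hCV : componentVertices C ⊆ polyVertices D :=
    (componentVertices_subset C).trans Set.sdiff_subset
  have hCD : componentVertices C ⊆ D := hCV.trans extremePoints_subset
  have hvDU : v ∈ D \ U := ⟨hCD hv, (componentVertices_subset C hv).2⟩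
  have hQU : x '' outerEdges D (componentVertices C) ⊆ U := by
    rintro _ ⟨e, he, rfl⟩; exact (hx e he).1
  have hQD : x '' outerEdges D (componentVertices C) ⊆ D := by
    rintro _ ⟨e, he, rfl⟩
    have hxe := (hx e he).2
    obtain ⟨a, -, b, -, -, -, hext⟩ := he
    exact hext.subset hxe
  have hQfin : (x '' outerEdges D (componentVertices C)).Finite :=
    (finite_outerEdges hD hCV).image x
  have hfin := hD.finite_polyVertices
  apply Set.Subset.antisymm
  · have hcover := subset_union_convexHull_outerEdges hD hCV ⟨v, hv⟩ fun e he => (hx e he).2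
    have hsub : pathComponentIn (D \ U) v ⊆ D \ U := pathComponentIn_subset
    have hvW : v ∈ pathComponentIn (D \ U) v := mem_pathComponentIn_self hvDU
    have hdisj : pathComponentIn (D \ U) v ∩
        (convexHull ℝ (x '' outerEdges D (componentVertices C) ∪ componentVertices C) ∩
          convexHull ℝ (x '' outerEdges D (componentVertices C) ∪
            polyVertices D \ componentVertices C)) = ∅ := by
      rw [Set.eq_empty_iff_forall_notMem]
      rintro z ⟨hz, hz0, hz1⟩
      obtain ⟨A, hA, hA', hzA, hUA⟩ := hU.exists_convex_compl_of_notMem (hsub hz).2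
      obtain ⟨p, hp, hpA⟩ :=
        exists_mem_of_mem_convexHull_union hA' (hQU.trans hUA) hz0 hzA
      obtain ⟨q, hq, hqA⟩ :=
        exists_mem_of_mem_convexHull_union hA' (hQU.trans hUA) hz1 hzA
      exact hq.2 (mem_componentVertices_of_convex_compl hD hA hA' hUA hp hpA hq.1 hqA)
    rcases isPreconnected_iff_subset_of_disjoint_closed.1
      (isPathConnected_pathComponentIn hvDU).isConnected.isPreconnected _ _
      ((hQfin.union (hfin.subset hCV)).isClosed_convexHull ℝ)
      ((hQfin.union (hfin.subset Set.sdiff_subset)).isClosed_convexHull ℝ)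
      (hsub.trans (Set.sdiff_subset.trans hcover)) hdisj with h | h
    · exact fun z hz => ⟨h hz, (hsub hz).2⟩
    · exact absurd (show v ∈ (∅ : Set _) from hdisj ▸
        ⟨hvW, subset_convexHull ℝ _ (Or.inr hv), h hvW⟩) (Set.notMem_empty v)
  -- A hemispace around `z` avoiding `U` misses the chosen points, so it must contain a vertex of
  -- `C`, to which `z` is joined.
  · rintro z ⟨hz, hzU⟩
    have hzD : z ∈ D := convexHull_min (Set.union_subset hQD hCD) hD.convex hz
    obtain ⟨A, hA, hA', hzA, hUA⟩ := hU.exists_convex_compl_of_notMem hzU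
    obtain ⟨p, hp, hpA⟩ :=
      exists_mem_of_mem_convexHull_union hA' (hQU.trans hUA) hz hzA
    exact (joinedIn_of_mem_componentVertices hv hp).trans
      (joinedIn_of_convex_compl hD.convex hA hUA (hCD hp) hpA hzD hzA)

theorem pathComponentIn_inter_polyVertices (hD : IsBoundedPolyhedron D) (hU : Convex ℝ U)
    {C : (cutGraph D U).ConnectedComponent} {v : EuclideanSpace ℝ (Fin n)}
    (hv : v ∈ componentVertices C) :
    pathComponentIn (D \ U) v ∩ polyVertices D = componentVertices C := by
  -- Any choice of points on the outer edges will do: it only gives access to the hull formula.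
  choose! x hx using fun e (he : e ∈ outerEdges D (componentVertices C)) =>
    inter_nonempty_of_mem_outerEdges he
  apply Set.Subset.antisymm
  · rintro w ⟨hw, hwD⟩
    rw [pathComponentIn_eq_convexHull_sdiff hD hU hv hx] at hw
    obtain ⟨A, hA, hA', hwA, hUA⟩ := hU.exists_convex_compl_of_notMem hw.2
    obtain ⟨p, hp, hpA⟩ := exists_mem_of_mem_convexHull_union hA'
      (Set.Subset.trans (by rintro _ ⟨e, he, rfl⟩; exact (hx e he).1) hUA) hw.1 hwA
    exact mem_componentVertices_of_convex_compl hD hA hA' hUA hp hpA hwD hwA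
  · exact fun w hw => ⟨joinedIn_of_mem_componentVertices hv hw,
      (componentVertices_subset C hw).1⟩

theorem exists_polyVertex_joinedIn (hD : IsBoundedPolyhedron D) (hU : Convex ℝ U)
    {y : EuclideanSpace ℝ (Fin n)} (hy : y ∈ D \ U) :
    ∃ v ∈ polyVertices D \ U, JoinedIn (D \ U) v y := by
  obtain ⟨A, hA, hA', hyA, hUA⟩ := hU.exists_convex_compl_of_notMem hy.2
  obtain ⟨v, hv, hvA⟩ :=
    exists_mem_of_mem_convexHull hA' (hD.convexHull_polyVertices.symm ▸ hy.1) hyA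
  exact ⟨v, ⟨hv, fun h => hUA h hvA⟩,
    joinedIn_of_convex_compl hD.convex hA hUA hv.1 hvA hy.1 hyA⟩

theorem IsPathComponentOf.eq_pathComponentIn {W P : Set (EuclideanSpace ℝ (Fin n))}
    (hW : IsPathComponentOf W P) {v : EuclideanSpace ℝ (Fin n)} (hv : v ∈ W) :
    W = pathComponentIn P v := by
  obtain ⟨y, -, rfl⟩ := hW
  exact (pathComponentIn_congr hv).symm

end CutGraph

/-- The path-connected components `W` of `D \ U` and the connected components `C` of the cut graph
correspond to each other by `W ∩ D₀ = componentVertices C`, and the component `W` corresponding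
to `C` is `conv (Q₀ ∪ V₀) \ U`, with `V₀ = componentVertices C` and `Q₀` any set
consisting of one point `x e ∈ U ∩ e` for each outer edge `e` of `V₀`. -/
theorem proposition2p8 {n : ℕ} (D U : Set (EuclideanSpace ℝ (Fin n)))
    (hD : IsBoundedPolyhedron D) (hU : Convex ℝ U) :
    (∀ W : Set (EuclideanSpace ℝ (Fin n)), IsPathComponentOf W (D \ U) →
      ∃! C : (cutGraph D U).ConnectedComponent, W ∩ polyVertices D = componentVertices C) ∧
    ∀ C : (cutGraph D U).ConnectedComponent,
      (∃! W : Set (EuclideanSpace ℝ (Fin n)),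
        IsPathComponentOf W (D \ U) ∧ W ∩ polyVertices D = componentVertices C) ∧
      ∀ x : Set (EuclideanSpace ℝ (Fin n)) → EuclideanSpace ℝ (Fin n),
        (∀ e ∈ outerEdges D (componentVertices C), x e ∈ U ∩ e) →
        ∀ W : Set (EuclideanSpace ℝ (Fin n)), IsPathComponentOf W (D \ U) →
          W ∩ polyVertices D = componentVertices C →
          W = convexHull ℝ
            (x '' outerEdges D (componentVertices C) ∪ componentVertices C) \ U := by
  refine ⟨?_, fun C => ?_⟩
  · rintro _ ⟨y, hy, rfl⟩
    obtain ⟨v, hv, hvy⟩ := exists_polyVertex_joinedIn hD hU hy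
    refine ⟨(cutGraph D U).connectedComponentMk ⟨v, hv⟩, ?_, fun C' hC' => ?_⟩
    · change pathComponentIn (D \ U) y ∩ polyVertices D = _
      rw [pathComponentIn_congr hvy]
      exact pathComponentIn_inter_polyVertices hD hU (mem_componentVertices_mk hv)
    · refine componentVertices_injective (hC'.symm.trans ?_)
      rw [pathComponentIn_congr hvy]
      exact pathComponentIn_inter_polyVertices hD hU (mem_componentVertices_mk hv)
  · obtain ⟨v, hv⟩ := componentVertices_nonempty C
    have hvDU : v ∈ D \ U :=
      ⟨(componentVertices_subset C hv).1.1, (componentVertices_subset C hv).2⟩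
    have huniq : ∀ W, IsPathComponentOf W (D \ U) → W ∩ polyVertices D = componentVertices C →
        W = pathComponentIn (D \ U) v := fun W hW hWC =>
      hW.eq_pathComponentIn (hWC.symm ▸ hv : v ∈ W ∩ polyVertices D).1
    refine ⟨⟨pathComponentIn (D \ U) v, ⟨⟨v, hvDU, rfl⟩,
      pathComponentIn_inter_polyVertices hD hU hv⟩, fun W hW => huniq W hW.1 hW.2⟩, ?_⟩
    intro x hx W hW hWC
    rw [huniq W hW hWC]
    exact pathComponentIn_eq_convexHull_sdiff hD hU hv hx
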